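/- A randomized mechanism $P_{Y|X^n}$ consists of an integer $n\ge 0$, measurable spaces $\mathcal X_1,\dots,\mathcal X_n$ (the alphabets of the database entries) and $\mathcal Y$ (the alphabet of the query response), and a Markov kernel from $\prod_i\mathcal X_i$ to $\mathcal Y$. For $\varepsilon,\delta\ge 0$ it satisfies $(\varepsilon,\delta)$-DP if for all database instances $x^n,\tilde x^n$ that differ in exactly one entry and all measurable $A\subseteq\mathcal Y$, $P_{Y|X^n=x^n}(A)\le e^{\varepsilon}P_{Y|X^n=\tilde x^n}(A)+\delta$ and $P_{Y|X^n=\tilde x^n}(A)\le e^{\varepsilon}P_{Y|X^n=x^n}(A)+\delta$. It satisfies $\varepsilon$-DP if it satisfies $(\varepsilon,0)$-DP. It satisfies $\varepsilon$-MI-DP if $$\sup_{i,\,P_{X^n}} I(X_i;Y\mid X^{-i})\le\varepsilon\ \text{nats},$$ where the supremum is over all $i\in\{1,\dots,n\}$ and all probability distributions $P_{X^n}$ of the database, $X^{-i}$ is the database without its $i$-th entry, and the conditional mutual information of random variables with values in arbitrary measurable spaces is $I(U;V\mid W)=\sup_{f,g}\mathbb E\left[I(f(U);g(V)\mid W=\cdot)\right]$,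 the supremum being over all finite-valued measurable functions $f,g$ and the inner term being the mutual information of the conditional joint distribution of the pair $(f(U),g(V))$ given $W$. For a class $\mathcal C$ of mechanisms, a privacy guarantee $\alpha$-DP is stronger than a privacy guarantee $\beta$-DP on $\mathcal C$ (written $\alpha\text{-DP}\succeq\beta\text{-DP}$) if for every $\beta'>0$ there is an $\alpha'>0$ such that every mechanism in $\mathcal C$ that satisfies $\alpha'$-DP satisfies $\beta'$-DP; for vector parameters the inequalities are meant coordinate-wise. The two guarantees are equal on $\mathcal C$ if each is stronger than the other on $\mathcal C$. **Theorem.** On the class of all randomized mechanisms, $$\varepsilon\text{-DP}\succeq\text{MI-DP}\succeq(\varepsilon,\delta)\text{-DP}.$$ Furthermore, for every $K\in\mathbb N$, on the class of all mechanisms with $\min\{|\mathcal Y|,\max_i|\mathcal X_i|\}\le K$, $$\text{MI-DP}=(\varepsilon,\delta)\text{-DP}.$$ In particular the parameters in the relation $(\varepsilon,\delta)\text{-DP}\succeq\text{MI-DP}$ depend on the mechanism only through the bound $K$ on $\min\{|\mathcal Y|,\max_i|\mathcal X_i|\}$. -/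

import Mathlib

open MeasureTheory ProbabilityTheory

open scoped ENNReal

universe u v

/-- A randomized mechanism `P_{Y|X^n}`: a database of `n` entries, the `i`-th of which takes values
in an arbitrary measurable space `X i`, a measurable space `Y` of query responses, and a Markov
kernel that gives the law of the response for each database instance. -/
structure Mechanism where
  n : ℕ
  X : Fin n → Type u
  Y : Type v
  [measX : ∀ i, MeasurableSpace (X i)]
  [measY : MeasurableSpace Y]
  kernel : Kernel (∀ i, X i) Y
  [markov : IsMarkovKernel kernel]

attribute [instance] Mechanism.measX Mechanism.measY Mechanism.markov

/-- `(ε, δ)`-closeness of two probability distributions on the same measurable space. -/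
def EDClose {Ω : Type*} [MeasurableSpace Ω] (ε δ : ℝ) (P Q : Measure Ω) : Prop :=
  (∀ A, MeasurableSet A → P.real A ≤ Real.exp ε * Q.real A + δ) ∧
    ∀ A, MeasurableSet A → Q.real A ≤ Real.exp ε * P.real A + δ

open Classical in
/-- Two database instances are neighbors if their Hamming distance is one. -/
def Neighbor {n : ℕ} {X : Fin n → Type*} (x x' : ∀ i, X i) : Prop :=
  hammingDist x x' = 1

/-- Mutual information, in nats, of a joint probability mass function `p` on a finite product. The
terms with `p a b = 0` vanish (`0 log 0 = 0`), and if `p a b > 0` then both marginals are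
positive. -/
noncomputable def finMutualInfo {k l : ℕ} (p : Fin k → Fin l → ℝ) : ℝ :=
  ∑ a, ∑ b, p a b * Real.log (p a b / ((∑ b', p a b') * ∑ a', p a' b))

/-- Conditional mutual information `I(U; V | W)`, in nats, of random variables with values in
arbitrary measurable spaces (Dobrushin, Wyner): the supremum, over all finite measurable
quantizations `f` of `U` and `g` of `V`, of the expectation of the mutual information between
`f(U)` and `g(V)` under their conditional joint law given `W`. No regular conditional laws of `U`
or `V` are needed for this; where they exist on standard Borel spaces it is
`E [D(P_{UV|W} ‖ P_{U|W} × P_{V|W})]`. The integrand is almost surely nonnegative. -/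
noncomputable def condMutualInfo {Ω α β γ : Type*} [MeasurableSpace Ω] [MeasurableSpace α]
    [MeasurableSpace β] [MeasurableSpace γ] (μ : Measure Ω)
    (U : Ω → α) (V : Ω → β) (W : Ω → γ) : ℝ≥0∞ :=
  ⨆ (k : ℕ) (l : ℕ) (f : α → Fin k) (_ : Measurable f) (g : β → Fin l) (_ : Measurable g),
    ∫⁻ ω, ENNReal.ofReal (finMutualInfo fun a b =>
      (μ⟦{ω' | f (U ω') = a ∧ g (V ω') = b} | MeasurableSpace.comap W inferInstance⟧) ω) ∂μ

namespace Mechanism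

/-- `(ε, δ)`-differential privacy. -/
def IsEDDP (M : Mechanism.{u, v}) (ε δ : ℝ) : Prop :=
  ∀ x x' : ∀ i, M.X i, Neighbor x x' → EDClose ε δ (M.kernel x) (M.kernel x')

/-- `ε`-differential privacy. -/
def IsEDP (M : Mechanism.{u, v}) (ε : ℝ) : Prop := M.IsEDDP ε 0

/-- `I(X_i; Y | X^{-i})` when the database has law `P` and `Y` is the response of the mechanism:
`P ⊗ₘ M.kernel` is the joint law of `(X^n, Y)`. -/
noncomputable def leakage (M : Mechanism.{u, v}) (i : Fin M.n) (P : Measure (∀ i, M.X i)) : ℝ≥0∞ :=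
  condMutualInfo (P ⊗ₘ M.kernel) (fun ω => ω.1 i) (fun ω => ω.2)
    (fun ω (j : {j : Fin M.n // j ≠ i}) => ω.1 j)

/-- `ε`-mutual-information differential privacy: the supremum of `I(X_i; Y | X^{-i})` over all
entries `i` and all database distributions is at most `ε` nats. -/
def IsMIDP (M : Mechanism.{u, v}) (ε : ℝ) : Prop :=
  (⨆ (i : Fin M.n) (P : Measure (∀ i, M.X i)) (_ : IsProbabilityMeasure P), M.leakage i P) ≤
    ENNReal.ofReal ε

/-- `min {|Y|, max_i |X_i|}`, possibly infinite. -/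
noncomputable def cardBound (M : Mechanism.{u, v}) : ℕ∞ :=
  min (ENat.card M.Y) (⨆ i, ENat.card (M.X i))

end Mechanism

/-- A privacy guarantee with `k` real parameters. -/
abbrev PrivacyMetric (k : ℕ) := (Fin k → ℝ) → Mechanism.{u, v} → Prop

/-- `ε`-DP, as a privacy guarantee with one parameter. -/
def epsDP : PrivacyMetric.{u, v} 1 := fun a M => M.IsEDP (a 0)

/-- MI-DP, as a privacy guarantee with one parameter. -/
def miDP : PrivacyMetric.{u, v} 1 := fun a M => M.IsMIDP (a 0)

/-- `(ε, δ)`-DP, as a privacy guarantee with two parameters. -/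
def epsDeltaDP : PrivacyMetric.{u, v} 2 := fun a M => M.IsEDDP (a 0) (a 1)

/-- `p` is stronger than `q` for the mechanisms of the class `C`: for all positive parameters `b`
there are positive parameters `a`, the same for the whole class, such that `p` with parameters `a`
implies `q` with parameters `b`. -/
def Stronger (C : Set Mechanism.{u, v}) {k l : ℕ}
    (p : PrivacyMetric.{u, v} k) (q : PrivacyMetric.{u, v} l) : Prop :=
  ∀ b : Fin l → ℝ, (∀ j, 0 < b j) → ∃ a : Fin k → ℝ, (∀ j, 0 < a j) ∧
    ∀ M ∈ C, p a M → q b M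

/-- Equality of privacy guarantees in the ordering, for the mechanisms of the class `C`. -/
def EquivalentDP (C : Set Mechanism.{u, v}) {k l : ℕ}
    (p : PrivacyMetric.{u, v} k) (q : PrivacyMetric.{u, v} l) : Prop :=
  Stronger C p q ∧ Stronger C q p

/-! From DP to MI-DP: fix the `i`-th entry of a reference database `x₀`. Given `X^{-i} = z`, every
output law is close to that of the database completing `z` by this entry, and this law depends on
`z` only. It therefore pulls out of conditional expectations, so that for any finite quantization
almost every conditional joint law is a finite matrix whose rows, once normalized, are all close to
one vector (`ae_condLaw_bounds`). This needs conditional probabilities of finitely many events only,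
hence no regular conditional laws. `IsEDDP.leakage_le` reduces the bound on the leakage to such
matrices. Multiplicative closeness gives mutual information at most `2 * ε` whatever the alphabets.
Additive closeness `η` gives `2 * η` per non-null row or per non-null column, which is where `K`
enters.

From MI-DP to `(ε, δ)`-DP: put the uniform law on two neighbors. Then `X^{-i}` is almost surely
constant, conditioning has no effect, and a Pinsker-type inequality for binary quantizations bounds
the difference of the output probabilities of any event (`IsMIDP.abs_sub_le`). -/

section FiniteMutualInformation

/-! ### Bounds on the mutual information of a finite joint law. -/

variable {k l : ℕ} {q : Fin k → Fin l → ℝ}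

theorem rowSum_nonneg (h0 : ∀ a b, 0 ≤ q a b) (a : Fin k) : 0 ≤ ∑ b, q a b :=
  Finset.sum_nonneg fun b _ => h0 a b

theorem colSum_nonneg (h0 : ∀ a b, 0 ≤ q a b) (b : Fin l) : 0 ≤ ∑ a, q a b :=
  Finset.sum_nonneg fun a _ => h0 a b

theorem le_rowSum (h0 : ∀ a b, 0 ≤ q a b) (a : Fin k) (b : Fin l) : q a b ≤ ∑ b', q a b' :=
  Finset.single_le_sum (f := fun b' => q a b') (fun b' _ => h0 a b') (Finset.mem_univ b)

theorem le_colSum (h0 : ∀ a b, 0 ≤ q a b) (a : Fin k) (b : Fin l) : q a b ≤ ∑ a', q a' b :=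
  Finset.single_le_sum (f := fun a' => q a' b) (fun a' _ => h0 a' b) (Finset.mem_univ a)

/-- A uniform multiplicative comparison of the rows bounds the mutual information. -/
theorem finMutualInfo_le_of_mul_close {ε : ℝ} (h0 : ∀ a b, 0 ≤ q a b)
    (h1 : ∑ a, ∑ b, q a b = 1) (h : Fin l → ℝ)
    (hU : ∀ a b, q a b ≤ Real.exp ε * h b * ∑ b', q a b')
    (hL : ∀ a b, h b * ∑ b', q a b' ≤ Real.exp ε * q a b) :
    finMutualInfo q ≤ 2 * ε := by
  have key : ∀ a b, q a b * Real.log (q a b / ((∑ b', q a b') * ∑ a', q a' b))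
      ≤ q a b * (2 * ε) := by
    intro a b
    rcases (h0 a b).eq_or_lt with hz | hp
    · simp [← hz]
    refine mul_le_mul_of_nonneg_left ?_ (h0 a b)
    have hr : 0 < ∑ b', q a b' := hp.trans_le (le_rowSum h0 a b)
    have hc : 0 < ∑ a', q a' b := hp.trans_le (le_colSum h0 a b)
    -- Averaging `hL` over the rows replaces the reference `h` by the column marginal. This costs
    -- the second factor `exp ε`, hence the `2 * ε`.
    have hb : h b ≤ Real.exp ε * ∑ a', q a' b := by
      calc h b = ∑ a', h b * ∑ b', q a' b' := by rw [← Finset.mul_sum, h1, mul_one]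
        _ ≤ ∑ a', Real.exp ε * q a' b := Finset.sum_le_sum fun a' _ => hL a' b
        _ = _ := by rw [Finset.mul_sum]
    rw [Real.log_le_iff_le_exp (by positivity), div_le_iff₀ (by positivity)]
    calc q a b ≤ Real.exp ε * h b * ∑ b', q a b' := hU a b
      _ ≤ Real.exp ε * (Real.exp ε * ∑ a', q a' b) * ∑ b', q a b' := by gcongr
      _ = _ := by rw [two_mul, Real.exp_add]; ring
  calc finMutualInfo q ≤ ∑ a, ∑ b, q a b * (2 * ε) :=
        Finset.sum_le_sum fun a _ => Finset.sum_le_sum fun b _ => key a b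
    _ = 2 * ε := by simp_rw [← Finset.sum_mul]; rw [h1, one_mul]

/-- If the sum of every row over `B` is additively close to a multiple of the row sums, then it is
close to the product of the marginals. -/
theorem abs_sum_sub_mul_le {η : ℝ} (h1 : ∑ a, ∑ b, q a b = 1)
    (B : Finset (Fin l)) (h : ℝ)
    (hc : ∀ a, |∑ b ∈ B, q a b - h * ∑ b, q a b| ≤ η * ∑ b, q a b) (h0 : ∀ a b, 0 ≤ q a b)
    (a : Fin k) :
    ∑ b ∈ B, (q a b - (∑ b', q a b') * ∑ a', q a' b) ≤ 2 * η * ∑ b, q a b := by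
  have hsum : h - η ≤ ∑ b ∈ B, ∑ a', q a' b := by
    rw [Finset.sum_comm]
    calc h - η = ∑ a', (h * ∑ b, q a' b - η * ∑ b, q a' b) := by
          rw [Finset.sum_sub_distrib, ← Finset.mul_sum, ← Finset.mul_sum, h1]; ring
      _ ≤ _ := Finset.sum_le_sum fun a' _ => by linarith [(abs_le.1 (hc a')).1]
  rw [Finset.sum_sub_distrib, ← Finset.mul_sum]
  have := mul_le_mul_of_nonneg_left hsum (rowSum_nonneg h0 a)
  linarith [(abs_le.1 (hc a)).2]

/-- From `log x ≤ x - 1`; this replaces each term of the mutual information by a term of χ² type,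
linear in the excess `p - r` up to a ratio that is easy to control. -/
theorem mul_log_div_le {p r : ℝ} (hp : 0 < p) (hr : 0 < r) :
    p * Real.log (p / r) ≤ p / r * (p - r) := by
  have h := Real.log_le_sub_one_of_pos (div_pos hp hr)
  calc p * Real.log (p / r) ≤ p * (p / r - 1) := mul_le_mul_of_nonneg_left h hp.le
    _ = _ := by field_simp

/-- Additive closeness bounds the mutual information by the number of non-null rows. -/
theorem finMutualInfo_le_of_rows {η : ℝ} (h0 : ∀ a b, 0 ≤ q a b)
    (hη : 0 ≤ η) (h1 : ∑ a, ∑ b, q a b = 1)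
    (hc : ∀ B : Finset (Fin l), ∃ h : ℝ, ∀ a,
      |∑ b ∈ B, q a b - h * ∑ b, q a b| ≤ η * ∑ b, q a b)
    (T : Finset (Fin k)) (hT : ∀ a ∉ T, ∀ b, q a b = 0) :
    finMutualInfo q ≤ 2 * η * T.card := by
  have hrow : ∀ a, ∑ b, q a b * Real.log (q a b / ((∑ b', q a b') * ∑ a', q a' b)) ≤ 2 * η := by
    intro a
    rcases (rowSum_nonneg h0 a).eq_or_lt with hz | hr
    · have : ∀ b, q a b = 0 := fun b =>
        le_antisymm ((le_rowSum h0 a b).trans hz.symm.le) (h0 a b)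
      simp only [this, zero_mul, Finset.sum_const_zero]; positivity
    -- Terms with negative excess only help, so closeness on the set of nonnegative excess controls
    -- the whole row, however many columns there are.
    set B := Finset.univ.filter fun b => 0 ≤ q a b - (∑ b', q a b') * ∑ a', q a' b with hB
    obtain ⟨h, hh⟩ := hc B
    have hBle := abs_sum_sub_mul_le h1 B h hh h0 a
    have hterm : ∀ b, q a b * Real.log (q a b / ((∑ b', q a b') * ∑ a', q a' b)) ≤
        if 0 ≤ q a b - (∑ b', q a b') * ∑ a', q a' b then
          (q a b - (∑ b', q a b') * ∑ a', q a' b) / ∑ b', q a b' else 0 := by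
      intro b
      rcases (h0 a b).eq_or_lt with hz | hp
      · rw [← hz, zero_mul]; split_ifs with hif
        · exact div_nonneg hif hr.le
        · exact le_rfl
      have hcol : 0 < ∑ a', q a' b := hp.trans_le (le_colSum h0 a b)
      refine (mul_log_div_le hp (mul_pos hr hcol)).trans ?_
      split_ifs with hif
      -- An entry is at most its column sum, which cancels the column marginal in the denominator.
      · rw [div_mul_eq_mul_div, div_le_div_iff₀ (by positivity) hr]
        have := le_colSum h0 a b
        calc _ ≤ (∑ a', q a' b) * (q a b - (∑ b', q a b') * ∑ a', q a' b) * ∑ b', q a b' := by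
              gcongr
          _ = _ := by ring
      · exact mul_nonpos_of_nonneg_of_nonpos (by positivity) (not_le.1 hif).le
    calc _ ≤ _ := Finset.sum_le_sum fun b _ => hterm b
      _ = (∑ b ∈ B, (q a b - (∑ b', q a b') * ∑ a', q a' b)) / ∑ b', q a b' := by
          rw [← Finset.sum_filter, Finset.sum_div]
      _ ≤ 2 * η := by rwa [div_le_iff₀ hr]
  calc finMutualInfo q
      = ∑ a ∈ T, ∑ b, q a b * Real.log (q a b / ((∑ b', q a b') * ∑ a', q a' b)) := by
        refine (Finset.sum_subset (Finset.subset_univ T) fun a _ ha => ?_).symm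
        exact Finset.sum_eq_zero fun b _ => by rw [hT a ha b, zero_mul]
    _ ≤ ∑ _a ∈ T, 2 * η := Finset.sum_le_sum fun a _ => hrow a
    _ = _ := by rw [Finset.sum_const, nsmul_eq_mul, mul_comm]

/-- Additive closeness bounds the mutual information by the number of non-null columns. -/
theorem finMutualInfo_le_of_cols {η : ℝ} (h0 : ∀ a b, 0 ≤ q a b)
    (hη : 0 ≤ η) (h1 : ∑ a, ∑ b, q a b = 1)
    (hc : ∀ B : Finset (Fin l), ∃ h : ℝ, ∀ a,
      |∑ b ∈ B, q a b - h * ∑ b, q a b| ≤ η * ∑ b, q a b)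
    (T : Finset (Fin l)) (hT : ∀ b ∉ T, ∀ a, q a b = 0) :
    finMutualInfo q ≤ 2 * η * T.card := by
  have hcol : ∀ b, ∑ a, q a b * Real.log (q a b / ((∑ b', q a b') * ∑ a', q a' b)) ≤ 2 * η := by
    intro b
    rcases (colSum_nonneg h0 b).eq_or_lt with hz | hr
    · have : ∀ a, q a b = 0 := fun a =>
        le_antisymm ((le_colSum h0 a b).trans hz.symm.le) (h0 a b)
      simp only [this, zero_mul, Finset.sum_const_zero]; positivity
    -- Closeness on one column bounds each excess by `2 * η` times the row sum. This cancels the row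
    -- marginal, and the remaining weights `q a b / ∑ a', q a' b` sum to one.
    obtain ⟨h, hh⟩ := hc {b}
    have hterm : ∀ a, q a b * Real.log (q a b / ((∑ b', q a b') * ∑ a', q a' b)) ≤
        2 * η / (∑ a', q a' b) * q a b := by
      intro a
      have hle := abs_sum_sub_mul_le h1 {b} h hh h0 a
      rw [Finset.sum_singleton] at hle
      rcases (h0 a b).eq_or_lt with hz | hp
      · simp [← hz]
      have hrow : 0 < ∑ b', q a b' := hp.trans_le (le_rowSum h0 a b)
      refine (mul_log_div_le hp (mul_pos hrow hr)).trans ?_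
      calc _ ≤ q a b / ((∑ b', q a b') * ∑ a', q a' b) * (2 * η * ∑ b', q a b') := by gcongr
        _ = _ := by field_simp
    calc _ ≤ _ := Finset.sum_le_sum fun a _ => hterm a
      _ = 2 * η := by rw [← Finset.mul_sum]; field_simp
  calc finMutualInfo q
      = ∑ b, ∑ a, q a b * Real.log (q a b / ((∑ b', q a b') * ∑ a', q a' b)) :=
        Finset.sum_comm
    _ = ∑ b ∈ T, ∑ a, q a b * Real.log (q a b / ((∑ b', q a b') * ∑ a', q a' b)) := by
        refine (Finset.sum_subset (Finset.subset_univ T) fun b _ hb => ?_).symm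
        exact Finset.sum_eq_zero fun a _ => by rw [hT b hb a, zero_mul]
    _ ≤ ∑ _b ∈ T, 2 * η := Finset.sum_le_sum fun b _ => hcol b
    _ = _ := by rw [Finset.sum_const, nsmul_eq_mul, mul_comm]

/-- With `p = s ^ 2` and `r = t ^ 2`, the bound `log x ≥ 1 - 1 / x` at `x = s / t` gives the
Hellinger-type remainder `(s - t) ^ 2`. It dominates `(p - r) ^ 2 / 4` because `s + t ≤ 2`. -/
theorem sub_add_sq_le_mul_log {p r : ℝ} (hp : 0 ≤ p) (hr : 0 ≤ r) (hp1 : p ≤ 1) (hr1 : r ≤ 1)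
    (hpr : r = 0 → p = 0) : p - r + (p - r) ^ 2 / 4 ≤ p * Real.log (p / r) := by
  rcases hp.eq_or_lt with rfl | hp
  · simp only [zero_mul]; nlinarith
  have hr : 0 < r := hr.lt_of_ne' fun h => hp.ne' (hpr h)
  obtain ⟨s, hs, rfl⟩ : ∃ s, 0 < s ∧ s ^ 2 = p := ⟨√p, Real.sqrt_pos.2 hp, Real.sq_sqrt hp.le⟩
  obtain ⟨t, ht, rfl⟩ : ∃ t, 0 < t ∧ t ^ 2 = r := ⟨√r, Real.sqrt_pos.2 hr, Real.sq_sqrt hr.le⟩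
  have hs1 : s ≤ 1 := by nlinarith
  have ht1 : t ≤ 1 := by nlinarith
  have hlog : 2 * (1 - t / s) ≤ Real.log (s ^ 2 / t ^ 2) := by
    rw [← div_pow, Real.log_pow, ← inv_div s t]
    have := Real.one_sub_inv_le_log_of_pos (div_pos hs ht)
    push_cast; linarith
  have h2 : s ^ 2 * (2 * (1 - t / s)) = s ^ 2 - t ^ 2 + (s - t) ^ 2 := by field_simp; ring
  have h3 : (s ^ 2 - t ^ 2) ^ 2 / 4 ≤ (s - t) ^ 2 := by
    have : (s + t) ^ 2 ≤ 4 := by nlinarith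
    nlinarith [mul_le_mul_of_nonneg_left this (sq_nonneg (s - t))]
  linarith [mul_le_mul_of_nonneg_left hlog (sq_nonneg s)]

/-- A Pinsker-type lower bound on the mutual information by one entry of the joint law. -/
theorem sq_div_four_le_finMutualInfo (h0 : ∀ a b, 0 ≤ q a b) (h1 : ∑ a, ∑ b, q a b = 1)
    (a : Fin k) (b : Fin l) :
    (q a b - (∑ b', q a b') * ∑ a', q a' b) ^ 2 / 4 ≤ finMutualInfo q := by
  have h1' : ∑ b, ∑ a, q a b = 1 := by rw [Finset.sum_comm, h1]
  have hrow1 : ∀ a, ∑ b, q a b ≤ 1 := fun a => h1 ▸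
    Finset.single_le_sum (f := fun a => ∑ b, q a b) (fun a _ => rowSum_nonneg h0 a)
      (Finset.mem_univ a)
  have hcol1 : ∀ b, ∑ a, q a b ≤ 1 := fun b => h1' ▸
    Finset.single_le_sum (f := fun b => ∑ a, q a b) (fun b _ => colSum_nonneg h0 b)
      (Finset.mem_univ b)
  have hterm : ∀ a b, (q a b - (∑ b', q a b') * ∑ a', q a' b) +
      (q a b - (∑ b', q a b') * ∑ a', q a' b) ^ 2 / 4 ≤
      q a b * Real.log (q a b / ((∑ b', q a b') * ∑ a', q a' b)) := by
    intro a b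
    refine sub_add_sq_le_mul_log (h0 a b) (mul_nonneg (rowSum_nonneg h0 a) (colSum_nonneg h0 b))
      ((le_rowSum h0 a b).trans (hrow1 a))
      (mul_le_one₀ (hrow1 a) (colSum_nonneg h0 b) (hcol1 b)) fun h => ?_
    rcases mul_eq_zero.1 h with h | h
    · exact le_antisymm (h ▸ le_rowSum h0 a b) (h0 a b)
    · exact le_antisymm (h ▸ le_colSum h0 a b) (h0 a b)
  calc _ ≤ ∑ a, ∑ b, (q a b - (∑ b', q a b') * ∑ a', q a' b) ^ 2 / 4 :=
        (Finset.single_le_sum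
          (f := fun b => (q a b - (∑ b', q a b') * ∑ a', q a' b) ^ 2 / 4)
          (fun b _ => by positivity) (Finset.mem_univ b)).trans
        (Finset.single_le_sum
          (f := fun a => ∑ b, (q a b - (∑ b', q a b') * ∑ a', q a' b) ^ 2 / 4)
          (fun a _ => Finset.sum_nonneg fun b _ => by positivity) (Finset.mem_univ a))
    -- The first-order terms cancel: the joint law and the product of its marginals both have total
    -- mass one.
    _ = ∑ a, ∑ b, ((q a b - (∑ b', q a b') * ∑ a', q a' b) +
          (q a b - (∑ b', q a b') * ∑ a', q a' b) ^ 2 / 4) := by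
        simp_rw [Finset.sum_add_distrib, Finset.sum_sub_distrib, ← Finset.mul_sum,
          ← Finset.sum_mul, h1', h1]
        ring
    _ ≤ _ := Finset.sum_le_sum fun a _ => Finset.sum_le_sum fun b _ => hterm a b

end FiniteMutualInformation

/-! ### Conditional laws of finite quantizations, given a function of the input. -/

section ConditionalLaw

variable {Ω 𝒳 𝒴 γ : Type*} [MeasurableSpace 𝒳] [MeasurableSpace 𝒴] [MeasurableSpace γ]

/-- Conditional probability is finitely additive over the values of a finite-valued map. -/
theorem sum_condProb_inter_fiber (m : MeasurableSpace Ω) {_ : MeasurableSpace Ω}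
    (μ : Measure Ω) [IsFiniteMeasure μ] {l : ℕ} {S : Set Ω} (hS : MeasurableSet S)
    {G : Ω → Fin l} (hG : Measurable G) (B : Finset (Fin l)) :
    (fun ω => ∑ b ∈ B, (μ⟦S ∩ G ⁻¹' {b} | m⟧) ω) =ᵐ[μ] μ⟦S ∩ G ⁻¹' B | m⟧ := by
  have hset : ∀ b, MeasurableSet (S ∩ G ⁻¹' {b}) := fun b => hS.inter (hG (measurableSet_singleton b))
  have h := condExp_finsetSum (μ := μ) (s := B)
    (f := fun b => (S ∩ G ⁻¹' {b}).indicator fun _ => (1 : ℝ))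
    (fun b _ => (integrable_const 1).indicator (hset b)) m
  have hind : (∑ b ∈ B, (S ∩ G ⁻¹' {b}).indicator fun _ => (1 : ℝ)) =
      (S ∩ G ⁻¹' B).indicator fun _ => 1 := by
    ext ω
    by_cases hω : ω ∈ S <;> simp [Set.indicator, hω]
  rw [hind] at h
  filter_upwards [h] with ω hω
  rw [hω, Finset.sum_apply]

variable {P : Measure 𝒳} [IsProbabilityMeasure P] {κ : Kernel 𝒳 𝒴} [IsMarkovKernel κ] {w : 𝒳 → γ}

theorem integrable_indicator_kernel {S : Set 𝒳} (hS : MeasurableSet S) {T : Set 𝒴}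
    (hT : MeasurableSet T) :
    Integrable ((Prod.fst ⁻¹' S).indicator fun ω : 𝒳 × 𝒴 => (κ ω.1).real T) (P ⊗ₘ κ) := by
  refine Integrable.indicator ?_ (measurable_fst hS)
  refine Integrable.of_bound (C := 1)
    ((κ.measurable_coe hT).ennreal_toReal.comp measurable_fst).aestronglyMeasurable ?_
  filter_upwards with ω
  rw [Real.norm_of_nonneg measureReal_nonneg]
  exact measureReal_le_one

/-- Given a function of the input of a kernel, the conditional probability of a rectangle is the
conditional expectation of the kernel on the input side of the rectangle. -/
theorem condProb_rectangle_eq (hw : Measurable w) {S : Set 𝒳} (hS : MeasurableSet S) {T : Set 𝒴}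
    (hT : MeasurableSet T) :
    (P ⊗ₘ κ)⟦(Prod.fst ⁻¹' S ∩ Prod.snd ⁻¹' T : Set (𝒳 × 𝒴)) |
        MeasurableSpace.comap (fun ω => w ω.1) inferInstance⟧ =ᵐ[P ⊗ₘ κ]
      (P ⊗ₘ κ)[(Prod.fst ⁻¹' S).indicator (fun ω : 𝒳 × 𝒴 => (κ ω.1).real T) |
        MeasurableSpace.comap (fun ω => w ω.1) inferInstance] := by
  have hm : MeasurableSpace.comap (fun ω : 𝒳 × 𝒴 => w ω.1) inferInstance ≤
      (inferInstance : MeasurableSpace (𝒳 × 𝒴)) := (hw.comp measurable_fst).comap_le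
  have hrect : MeasurableSet (Prod.fst ⁻¹' S ∩ Prod.snd ⁻¹' T : Set (𝒳 × 𝒴)) :=
    (measurable_fst hS).inter (measurable_snd hT)
  symm
  refine ae_eq_condExp_of_forall_setIntegral_eq hm ((integrable_const (1 : ℝ)).indicator hrect)
    (fun s _ _ => integrable_condExp.integrableOn) ?_
    stronglyMeasurable_condExp.aestronglyMeasurable
  rintro _ ⟨D, hD, rfl⟩ -
  have hDm : MeasurableSet (w ⁻¹' D) := hw hD
  have hint := integrable_indicator_kernel (P := P) (κ := κ) hS hT
  rw [setIntegral_condExp hm hint ⟨D, hD, rfl⟩]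
  -- Conditioning events constrain the input only, so both set integrals disintegrate over `P` and
  -- the inner integrals over the output can be compared at each input.
  have e1 : (fun ω : 𝒳 × 𝒴 => w ω.1) ⁻¹' D = (w ⁻¹' D) ×ˢ Set.univ := by ext; simp
  rw [e1, Measure.setIntegral_compProd hDm MeasurableSet.univ hint.integrableOn,
    Measure.setIntegral_compProd hDm MeasurableSet.univ
      ((integrable_const (1 : ℝ)).indicator hrect).integrableOn]
  refine integral_congr_ae (Filter.Eventually.of_forall fun x => ?_)
  beta_reduce
  rw [Measure.restrict_univ]
  by_cases hx : x ∈ S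
  · have : (fun y => (Prod.fst ⁻¹' S ∩ Prod.snd ⁻¹' T : Set (𝒳 × 𝒴)).indicator
        (fun _ => (1 : ℝ)) (x, y)) = T.indicator fun _ => 1 := by
      ext y; by_cases hy : y ∈ T <;> simp [hx, hy]
    rw [this, integral_indicator hT]
    simp [Set.indicator, hx]
  · simp [Set.indicator, hx]

/-- The pull-out property: `H ∘ w` is measurable for the conditioning σ-algebra. Applied to upper
and lower bounds on the kernel, it turns them into bounds on conditional probabilities. -/
theorem condExp_indicator_comp_mul (hw : Measurable w) {S : Set 𝒳} (hS : MeasurableSet S)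
    {H : γ → ℝ} (hH : Measurable H) {c : ℝ} (hc : ∀ z, |H z| ≤ c) :
    Integrable ((Prod.fst ⁻¹' S).indicator (fun ω : 𝒳 × 𝒴 => H (w ω.1))) (P ⊗ₘ κ) ∧
    (P ⊗ₘ κ)[(Prod.fst ⁻¹' S).indicator (fun ω : 𝒳 × 𝒴 => H (w ω.1)) |
        MeasurableSpace.comap (fun ω => w ω.1) inferInstance] =ᵐ[P ⊗ₘ κ]
      fun ω => H (w ω.1) * ((P ⊗ₘ κ)⟦(Prod.fst ⁻¹' S : Set (𝒳 × 𝒴)) |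
        MeasurableSpace.comap (fun ω => w ω.1) inferInstance⟧) ω := by
  have hm : MeasurableSpace.comap (fun ω : 𝒳 × 𝒴 => w ω.1) inferInstance ≤
      (inferInstance : MeasurableSpace (𝒳 × 𝒴)) := (hw.comp measurable_fst).comap_le
  have hHw : StronglyMeasurable[MeasurableSpace.comap (fun ω : 𝒳 × 𝒴 => w ω.1) inferInstance]
      fun ω : 𝒳 × 𝒴 => H (w ω.1) :=
    (hH.comp (comap_measurable fun ω : 𝒳 × 𝒴 => w ω.1)).stronglyMeasurable
  refine ⟨?_, ?_⟩
  · refine Integrable.indicator ?_ (measurable_fst hS)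
    exact Integrable.of_bound (C := c) (hHw.mono hm).aestronglyMeasurable
      (Filter.Eventually.of_forall fun ω => hc _)
  · have h := condExp_stronglyMeasurable_mul_of_bound hm (μ := P ⊗ₘ κ) hHw
      ((integrable_const (1 : ℝ)).indicator (measurable_fst hS : MeasurableSet (Prod.fst ⁻¹' S)))
      c (Filter.Eventually.of_forall fun ω => hc _)
    have e : ((Prod.fst ⁻¹' S).indicator (fun ω : 𝒳 × 𝒴 => H (w ω.1))) =
        (fun ω : 𝒳 × 𝒴 => H (w ω.1)) * (Prod.fst ⁻¹' S).indicator fun _ => (1 : ℝ) := by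
      ext ω; simp [Set.indicator]
    rw [e]; exact h

theorem condProb_rectangle_le (hw : Measurable w) {S : Set 𝒳} (hS : MeasurableSet S) {T : Set 𝒴}
    (hT : MeasurableSet T) {H : γ → ℝ} (hH : Measurable H) {c : ℝ} (hc : ∀ z, |H z| ≤ c)
    (hle : ∀ x, (κ x).real T ≤ H (w x)) :
    ∀ᵐ ω ∂(P ⊗ₘ κ), ((P ⊗ₘ κ)⟦(Prod.fst ⁻¹' S ∩ Prod.snd ⁻¹' T : Set (𝒳 × 𝒴)) |
        MeasurableSpace.comap (fun ω => w ω.1) inferInstance⟧) ω ≤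
      H (w ω.1) * ((P ⊗ₘ κ)⟦(Prod.fst ⁻¹' S : Set (𝒳 × 𝒴)) |
        MeasurableSpace.comap (fun ω => w ω.1) inferInstance⟧) ω := by
  obtain ⟨hint, heq⟩ := condExp_indicator_comp_mul (P := P) (κ := κ) hw hS hH hc
  have hmono := condExp_mono (m := MeasurableSpace.comap (fun ω : 𝒳 × 𝒴 => w ω.1) inferInstance)
    (integrable_indicator_kernel (P := P) (κ := κ) hS hT) hint
    (Filter.Eventually.of_forall fun ω => Set.indicator_le_indicator (hle ω.1))
  filter_upwards [condProb_rectangle_eq (P := P) (κ := κ) hw hS hT, heq, hmono] with ω h1 h2 h3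
  rw [h1, ← h2]; exact h3

theorem le_condProb_rectangle (hw : Measurable w) {S : Set 𝒳} (hS : MeasurableSet S) {T : Set 𝒴}
    (hT : MeasurableSet T) {H : γ → ℝ} (hH : Measurable H) {c : ℝ} (hc : ∀ z, |H z| ≤ c)
    (hle : ∀ x, H (w x) ≤ (κ x).real T) :
    ∀ᵐ ω ∂(P ⊗ₘ κ), H (w ω.1) * ((P ⊗ₘ κ)⟦(Prod.fst ⁻¹' S : Set (𝒳 × 𝒴)) |
        MeasurableSpace.comap (fun ω => w ω.1) inferInstance⟧) ω ≤
      ((P ⊗ₘ κ)⟦(Prod.fst ⁻¹' S ∩ Prod.snd ⁻¹' T : Set (𝒳 × 𝒴)) |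
        MeasurableSpace.comap (fun ω => w ω.1) inferInstance⟧) ω := by
  obtain ⟨hint, heq⟩ := condExp_indicator_comp_mul (P := P) (κ := κ) hw hS hH hc
  have hmono := condExp_mono (m := MeasurableSpace.comap (fun ω : 𝒳 × 𝒴 => w ω.1) inferInstance)
    hint (integrable_indicator_kernel (P := P) (κ := κ) hS hT)
    (Filter.Eventually.of_forall fun ω => Set.indicator_le_indicator (hle ω.1))
  filter_upwards [condProb_rectangle_eq (P := P) (κ := κ) hw hS hT, heq, hmono] with ω h1 h2 h3
  rw [h1, ← h2]; exact h3

/-- If every output law is `(ε, δ)`-close to a law that depends on the conditioning variable only,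
then so are the conditional joint laws of all finite quantizations. -/
theorem ae_condLaw_bounds {α : Type*} [MeasurableSpace α] {ε δ : ℝ} (hδ : 0 ≤ δ)
    {r : 𝒳 → α} (hr : Measurable r) (hw : Measurable w) {e : γ → 𝒳} (he : Measurable e)
    (hclose : ∀ x, EDClose ε δ (κ x) (κ (e (w x))))
    {k l : ℕ} {f : α → Fin k} (hf : Measurable f) {g : 𝒴 → Fin l} (hg : Measurable g)
    {q : 𝒳 × 𝒴 → Fin k → Fin l → ℝ}
    (hq : q = fun ω a b => ((P ⊗ₘ κ)⟦{ω' | f (r ω'.1) = a ∧ g ω'.2 = b} |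
      MeasurableSpace.comap (fun ω' => w ω'.1) inferInstance⟧) ω) :
    ∀ᵐ ω ∂(P ⊗ₘ κ), (∀ a b, 0 ≤ q ω a b) ∧ ∑ a, ∑ b, q ω a b = 1 ∧
      ∀ B : Finset (Fin l), ∃ h : ℝ, 0 ≤ h ∧ h ≤ 1 ∧ ∀ a,
        ∑ b ∈ B, q ω a b ≤ (Real.exp ε * h + δ) * ∑ b, q ω a b ∧
        h * ∑ b, q ω a b ≤ Real.exp ε * ∑ b ∈ B, q ω a b + δ * ∑ b, q ω a b := by
  set μ := P ⊗ₘ κ with hμ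
  have hm : MeasurableSpace.comap (fun ω : 𝒳 × 𝒴 => w ω.1) inferInstance ≤
      (inferInstance : MeasurableSpace (𝒳 × 𝒴)) := (hw.comp measurable_fst).comap_le
  let S : Fin k → Set 𝒳 := fun a => (fun x => f (r x)) ⁻¹' {a}
  have hS : ∀ a, MeasurableSet (S a) := fun a => hf.comp hr (measurableSet_singleton a)
  have hgs : Measurable fun ω : 𝒳 × 𝒴 => g ω.2 := hg.comp measurable_snd
  have hfs : Measurable fun ω : 𝒳 × 𝒴 => f (r ω.1) := hf.comp (hr.comp measurable_fst)
  have hSm : ∀ a, MeasurableSet (Prod.fst ⁻¹' S a : Set (𝒳 × 𝒴)) := fun a => measurable_fst (hS a)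
  set m := MeasurableSpace.comap (fun ω : 𝒳 × 𝒴 => w ω.1) inferInstance with hm_def
  have hT : ∀ B : Finset (Fin l), MeasurableSet (g ⁻¹' (B : Set (Fin l))) :=
    fun B => hg B.measurableSet
  have hqset : ∀ a b, {ω' : 𝒳 × 𝒴 | f (r ω'.1) = a ∧ g ω'.2 = b} =
      Prod.fst ⁻¹' S a ∩ (fun ω : 𝒳 × 𝒴 => g ω.2) ⁻¹' {b} := fun a b => by ext; simp [S]
  -- The reference law is the output law at the input `e z`, a measurable function of the
  -- conditioning variable.
  let h : Finset (Fin l) → γ → ℝ := fun B z => (κ (e z)).real (g ⁻¹' (B : Set (Fin l)))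
  have hh : ∀ B, Measurable (h B) := fun B =>
    ((κ.measurable_coe (hT B)).comp he).ennreal_toReal
  have hh0 : ∀ B z, 0 ≤ h B z := fun B z => measureReal_nonneg
  have hh1 : ∀ B z, h B z ≤ 1 := fun B z => measureReal_le_one
  have hsum : ∀ a, ∀ B : Finset (Fin l), ∀ᵐ ω ∂μ,
      ∑ b ∈ B, q ω a b = (μ⟦Prod.fst ⁻¹' S a ∩ Prod.snd ⁻¹' (g ⁻¹' (B : Set (Fin l))) | m⟧) ω := by
    intro a B
    filter_upwards [sum_condProb_inter_fiber m μ (hSm a) hgs B] with ω hω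
    simp only [hq, hqset]
    exact hω
  have hrow : ∀ a, ∀ᵐ ω ∂μ, ∑ b, q ω a b = (μ⟦Prod.fst ⁻¹' S a | m⟧) ω := by
    intro a
    filter_upwards [hsum a Finset.univ] with ω hω
    rw [hω]
    simp
  have hnonneg : ∀ a b, ∀ᵐ ω ∂μ, 0 ≤ q ω a b := by
    intro a b
    rw [hq]
    exact condExp_nonneg (Filter.Eventually.of_forall fun ω =>
      Set.indicator_nonneg (fun _ _ => zero_le_one) ω)
  have htot : ∀ᵐ ω ∂μ, ∑ a, (μ⟦Prod.fst ⁻¹' S a | m⟧) ω = 1 := by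
    filter_upwards [sum_condProb_inter_fiber m μ MeasurableSet.univ hfs Finset.univ] with ω hω
    have e1 : ∀ a, (Set.univ ∩ (fun ω : 𝒳 × 𝒴 => f (r ω.1)) ⁻¹' {a}) = Prod.fst ⁻¹' S a := by
      intro a; ext; simp [S]
    simp only [e1] at hω
    rw [hω]
    simp [condExp_const hm]
  have hupper : ∀ a, ∀ B : Finset (Fin l), ∀ᵐ ω ∂μ,
      (μ⟦Prod.fst ⁻¹' S a ∩ Prod.snd ⁻¹' (g ⁻¹' (B : Set (Fin l))) | m⟧) ω ≤
        (Real.exp ε * h B (w ω.1) + δ) * (μ⟦Prod.fst ⁻¹' S a | m⟧) ω := fun a B =>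
    condProb_rectangle_le hw (hS a) (hT B) (H := fun z => Real.exp ε * h B z + δ)
      (((hh B).const_mul _).add_const _) (c := Real.exp ε * 1 + δ)
      (fun z => by
        rw [abs_of_nonneg (by have := hh0 B z; positivity)]
        gcongr; exact hh1 B z)
      (fun x => (hclose x).1 _ (hT B))
  have hlower : ∀ a, ∀ B : Finset (Fin l), ∀ᵐ ω ∂μ,
      Real.exp (-ε) * (h B (w ω.1) - δ) * (μ⟦Prod.fst ⁻¹' S a | m⟧) ω ≤
      (μ⟦Prod.fst ⁻¹' S a ∩ Prod.snd ⁻¹' (g ⁻¹' (B : Set (Fin l))) | m⟧) ω := fun a B =>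
    le_condProb_rectangle hw (hS a) (hT B) (H := fun z => Real.exp (-ε) * (h B z - δ))
      (((hh B).sub_const _).const_mul _) (c := Real.exp (-ε) * (1 + δ))
      (fun z => by
        rw [abs_mul, abs_of_pos (Real.exp_pos _)]
        gcongr
        rw [abs_le]; constructor <;> linarith [hh0 B z, hh1 B z])
      (fun x => by
        rw [Real.exp_neg, inv_mul_le_iff₀ (Real.exp_pos _)]
        linarith [(hclose x).2 _ (hT B)])
  -- The indices `a`, `b`, `B` range over finite types, so one null set serves for all of them.
  simp only [← ae_all_iff] at hsum hrow hnonneg hupper hlower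
  filter_upwards [hsum, hrow, hnonneg, hupper, hlower, htot] with ω h1 h2 h3 h4 h5 h6
  refine ⟨h3, by simpa only [h2] using h6, fun B => ⟨h B (w ω.1), hh0 B _, hh1 B _, fun a => ?_⟩⟩
  rw [h1, h2]
  refine ⟨h4 a B, ?_⟩
  have := mul_le_mul_of_nonneg_left (h5 a B) (Real.exp_pos ε).le
  rw [← mul_assoc, ← mul_assoc, ← Real.exp_add, add_neg_cancel, Real.exp_zero] at this
  linarith

end ConditionalLaw

/-! ### Differential privacy bounds the leakage. -/

section UpperBounds

variable {n : ℕ} {X : Fin n → Type*}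

/-- Complete a database without its `i`-th entry by the `i`-th entry of `x₀`. -/
def completeWith (x₀ : ∀ i, X i) (i : Fin n) (z : ∀ j : {j : Fin n // j ≠ i}, X j) : ∀ j, X j :=
  fun j => if h : j ≠ i then z ⟨j, h⟩ else x₀ j

theorem measurable_completeWith [∀ i, MeasurableSpace (X i)] (x₀ : ∀ i, X i) (i : Fin n) :
    Measurable (completeWith x₀ i) := by
  refine measurable_pi_iff.2 fun j => ?_
  by_cases h : j ≠ i
  · simpa only [completeWith, h, dif_pos, ne_eq, not_false_eq_true] using
      measurable_pi_apply (⟨j, h⟩ : {j : Fin n // j ≠ i})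
  · simp only [completeWith, h, dif_neg, not_false_eq_true]
    exact measurable_const

theorem eq_or_neighbor_completeWith (x₀ x : ∀ i, X i) (i : Fin n) :
    completeWith x₀ i (fun j => x j) = x ∨
      Neighbor x (completeWith x₀ i fun j => x j) := by
  classical
  by_cases h : x i = x₀ i
  · left
    ext j
    by_cases hj : j = i
    · subst hj; simp [completeWith, h]
    · simp [completeWith, hj]
  · right
    unfold Neighbor hammingDist
    rw [Finset.card_eq_one]
    refine ⟨i, ?_⟩
    ext j
    by_cases hj : j = i
    · subst hj; simp [completeWith, h]
    · simp [completeWith, hj]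

theorem EDClose.refl {Ω : Type*} [MeasurableSpace Ω] {ε δ : ℝ} (hε : 0 ≤ ε) (hδ : 0 ≤ δ)
    (P : Measure Ω) : EDClose ε δ P P := by
  have h : ∀ A, P.real A ≤ Real.exp ε * P.real A + δ := fun A => by
    have h1 : 1 ≤ Real.exp ε := Real.one_le_exp hε
    have h2 : 0 ≤ P.real A := measureReal_nonneg
    nlinarith
  exact ⟨fun A _ => h A, fun A _ => h A⟩

/-- The number `k` of labels of a quantization is arbitrary, but only `K` of them can be attained;
this makes the bounds uniform over quantizations. -/
theorem exists_finset_card_le_of_range {α : Type*} {k K : ℕ} (h : ENat.card α ≤ K)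
    (f : α → Fin k) : ∃ T : Finset (Fin k), T.card ≤ K ∧ ∀ a ∉ T, a ∉ Set.range f := by
  classical
  have : Finite α := by
    rw [← not_infinite_iff_finite]
    intro hi
    rw [ENat.card_eq_top_of_infinite] at h
    simp at h
  have := Fintype.ofFinite α
  refine ⟨Finset.univ.image f, ?_, fun a ha => by simpa using ha⟩
  rw [ENat.card_eq_coe_fintype_card] at h
  exact Finset.card_image_le.trans (by simpa using h)

namespace Mechanism

/-- The integrand is bounded almost everywhere by `c` and the joint law is a probability measure, so
only a statement `hc` on finite matrices remains. Its vanishing condition outside the ranges carries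
the information on the alphabet sizes. -/
theorem IsEDDP.leakage_le {M : Mechanism.{u, v}} {ε δ c : ℝ} (hε : 0 ≤ ε) (hδ : 0 ≤ δ)
    (hM : M.IsEDDP ε δ) (i : Fin M.n) (P : Measure (∀ i, M.X i)) [IsProbabilityMeasure P]
    (hc : ∀ (k l : ℕ) (f : M.X i → Fin k) (g : M.Y → Fin l) (q : Fin k → Fin l → ℝ),
      (∀ a b, 0 ≤ q a b) → ∑ a, ∑ b, q a b = 1 →
      (∀ a b, a ∉ Set.range f ∨ b ∉ Set.range g → q a b = 0) →
      (∀ B : Finset (Fin l), ∃ h : ℝ, 0 ≤ h ∧ h ≤ 1 ∧ ∀ a,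
        ∑ b ∈ B, q a b ≤ (Real.exp ε * h + δ) * ∑ b, q a b ∧
        h * ∑ b, q a b ≤ Real.exp ε * ∑ b ∈ B, q a b + δ * ∑ b, q a b) →
      finMutualInfo q ≤ c) :
    M.leakage i P ≤ ENNReal.ofReal c := by
  obtain ⟨x₀⟩ : Nonempty (∀ i, M.X i) := nonempty_of_isProbabilityMeasure P
  refine iSup_le fun k => iSup_le fun l => iSup_le fun f => iSup_le fun hf =>
    iSup_le fun g => iSup_le fun hg => ?_
  have hw : Measurable fun (x : ∀ i, M.X i) (j : {j : Fin M.n // j ≠ i}) => x j :=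
    measurable_pi_iff.2 fun j => measurable_pi_apply _
  have hclose : ∀ x, EDClose ε δ (M.kernel x)
      (M.kernel (completeWith x₀ i fun j : {j : Fin M.n // j ≠ i} => x j)) := fun x => by
    rcases eq_or_neighbor_completeWith x₀ x i with h | h
    · rw [h]; exact EDClose.refl hε hδ _
    · exact hM _ _ h
  have hb := ae_condLaw_bounds (P := P) (κ := M.kernel) hδ (measurable_pi_apply i) hw
    (measurable_completeWith x₀ i) hclose hf hg rfl
  refine (lintegral_mono_ae (g := fun _ => ENNReal.ofReal c) ?_).trans (by simp)
  filter_upwards [hb] with ω hω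
  refine ENNReal.ofReal_le_ofReal (hc k l f g _ hω.1 hω.2.1 (fun a b hab => ?_) hω.2.2)
  -- For labels that are not attained the event is empty, and its conditional probability vanishes
  -- everywhere.
  have he : {ω' : (∀ i, M.X i) × M.Y | f (ω'.1 i) = a ∧ g ω'.2 = b} = ∅ := by
    ext ω'
    simp only [Set.mem_ofPred_eq, Set.mem_empty_iff_false, iff_false]
    rintro ⟨rfl, rfl⟩
    simp at hab
  rw [he, Set.indicator_empty]
  exact congrFun condExp_zero ω

theorem IsEDP.isMIDP {M : Mechanism.{u, v}} {ε : ℝ} (hε : 0 ≤ ε) (hM : M.IsEDP ε) :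
    M.IsMIDP (2 * ε) := by
  refine iSup_le fun i => iSup_le fun P => iSup_le fun _ => ?_
  refine IsEDDP.leakage_le hε le_rfl hM i P fun k l f g q h0 h1 _ hB => ?_
  choose h _ _ hh using fun b => hB {b}
  refine finMutualInfo_le_of_mul_close h0 h1 h (fun a b => ?_) (fun a b => ?_)
  · simpa using (hh b a).1
  · simpa using (hh b a).2

theorem IsEDDP.isMIDP {M : Mechanism.{u, v}} {ε δ : ℝ} {K : ℕ} (hε : 0 ≤ ε) (hδ : 0 ≤ δ)
    (hK : M.cardBound ≤ K) (hM : M.IsEDDP ε δ) :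
    M.IsMIDP (2 * (Real.exp ε - 1 + δ) * K) := by
  refine iSup_le fun i => iSup_le fun P => iSup_le fun _ => ?_
  refine IsEDDP.leakage_le hε hδ hM i P fun k l f g q h0 h1 hr hB => ?_
  have hexp : 0 ≤ Real.exp ε - 1 := by linarith [Real.one_le_exp hε]
  have hη : 0 ≤ Real.exp ε - 1 + δ := by positivity
  -- Since `h ≤ 1` and partial row sums are at most the row sum, the factor `exp ε` costs at most
  -- the additive error `exp ε - 1` relative to the row sum.
  have hclose : ∀ B : Finset (Fin l), ∃ h : ℝ, ∀ a,
      |∑ b ∈ B, q a b - h * ∑ b, q a b| ≤ (Real.exp ε - 1 + δ) * ∑ b, q a b := by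
    intro B
    obtain ⟨h, hh0, hh1, hh⟩ := hB B
    refine ⟨h, fun a => ?_⟩
    have hle : ∑ b ∈ B, q a b ≤ ∑ b, q a b :=
      Finset.sum_le_sum_of_subset_of_nonneg (Finset.subset_univ B) fun b _ _ => h0 a b
    have hrow := rowSum_nonneg h0 a
    have e1 := mul_le_mul_of_nonneg_left hle hexp
    have e2 := mul_le_mul_of_nonneg_left (mul_le_of_le_one_left hrow hh1) hexp
    obtain ⟨h2, h3⟩ := hh a
    rw [abs_le]
    constructor <;> linarith
  rcases min_le_iff.1 hK with hY | hX
  · obtain ⟨T, hT, hT0⟩ := exists_finset_card_le_of_range hY g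
    refine (finMutualInfo_le_of_cols h0 hη h1 hclose T fun b hb a =>
      hr a b (Or.inr (hT0 b hb))).trans ?_
    gcongr
  · obtain ⟨T, hT, hT0⟩ := exists_finset_card_le_of_range ((le_iSup _ i).trans hX) f
    refine (finMutualInfo_le_of_rows h0 hη h1 hclose T fun a ha b =>
      hr a b (Or.inl (hT0 a ha))).trans ?_
    gcongr

end Mechanism

end UpperBounds

/-! ### Leakage under the uniform distribution on two databases. -/

section TwoPoint

variable {𝒳 𝒴 γ : Type*} [MeasurableSpace 𝒳] [MeasurableSpace 𝒴] [MeasurableSpace γ]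

/-- The uniform distribution on two points. -/
noncomputable def twoPoint (x x' : 𝒳) : Measure 𝒳 :=
  (2⁻¹ : ℝ≥0∞) • (Measure.dirac x + Measure.dirac x')

instance isProbabilityMeasure_twoPoint (x x' : 𝒳) : IsProbabilityMeasure (twoPoint x x') := by
  constructor
  simp only [twoPoint, Measure.smul_apply, Measure.add_apply, measure_univ, smul_eq_mul]
  rw [one_add_one_eq_two]
  exact ENNReal.inv_mul_cancel (by simp) (by simp)

variable {κ : Kernel 𝒳 𝒴} [IsMarkovKernel κ]

theorem twoPoint_compProd_real_prod (x x' : 𝒳) {S : Set 𝒳} (hS : MeasurableSet S) {T : Set 𝒴}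
    (hT : MeasurableSet T) :
    (twoPoint x x' ⊗ₘ κ).real (S ×ˢ T) =
      (S.indicator (fun z => (κ z).real T) x + S.indicator (fun z => (κ z).real T) x') / 2 := by
  have hm : Measurable (S.indicator fun z => κ z T) := (κ.measurable_coe hT).indicator hS
  have e : ∀ z, (S.indicator (fun z => κ z T) z).toReal = S.indicator (fun z => (κ z).real T) z := by
    intro z
    by_cases hz : z ∈ S <;> simp [hz, Measure.real]
  have hfin : ∀ z, S.indicator (fun z => κ z T) z ≠ ∞ := by
    intro z
    by_cases hz : z ∈ S <;> simp [hz]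
  rw [Measure.real, Measure.compProd_apply_prod hS hT, ← lintegral_indicator hS, twoPoint,
    lintegral_smul_measure, lintegral_add_measure, lintegral_dirac' _ hm, lintegral_dirac' _ hm,
    smul_eq_mul, ENNReal.toReal_mul, ENNReal.toReal_add (hfin x) (hfin x'), e, e]
  simp only [ENNReal.toReal_inv, ENNReal.toReal_ofNat]
  ring

/-- Conditioning on a variable that does not separate the two points has no effect. -/
theorem condProb_twoPoint {x x' : 𝒳} {w : 𝒳 → γ} (hw : Measurable w) (hxx : w x = w x')
    {s : Set (𝒳 × 𝒴)} (hs : MeasurableSet s) :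
    (twoPoint x x' ⊗ₘ κ)⟦s | MeasurableSpace.comap (fun ω => w ω.1) inferInstance⟧
      =ᵐ[twoPoint x x' ⊗ₘ κ] fun _ => (twoPoint x x' ⊗ₘ κ).real s := by
  have hm : MeasurableSpace.comap (fun ω : 𝒳 × 𝒴 => w ω.1) inferInstance ≤
      (inferInstance : MeasurableSpace (𝒳 × 𝒴)) := (hw.comp measurable_fst).comap_le
  -- Every conditioning event has probability `0` or `1`, because `w` takes the same value at both
  -- points; such a σ-algebra is independent of everything.
  have hind : Indep (inferInstance : MeasurableSpace (𝒳 × 𝒴))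
      (MeasurableSpace.comap (fun ω : 𝒳 × 𝒴 => w ω.1) inferInstance) (twoPoint x x' ⊗ₘ κ) := by
    rw [Indep_iff]
    rintro t _ - ⟨D, hD, rfl⟩
    have hDm : MeasurableSet (w ⁻¹' D) := hw hD
    have e1 : (fun ω : 𝒳 × 𝒴 => w ω.1) ⁻¹' D = (w ⁻¹' D) ×ˢ Set.univ := by ext; simp
    have hval : (twoPoint x x' ⊗ₘ κ).real ((fun ω : 𝒳 × 𝒴 => w ω.1) ⁻¹' D) =
        D.indicator (fun _ => 1) (w x) := by
      rw [e1, twoPoint_compProd_real_prod x x' hDm MeasurableSet.univ]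
      by_cases h : w x ∈ D
      · have h' : w x' ∈ D := hxx ▸ h
        simp [h, h']
      · have h' : w x' ∉ D := hxx ▸ h
        simp [h, h']
    by_cases h : w x ∈ D
    · rw [Set.indicator_of_mem h] at hval
      have h1 : (twoPoint x x' ⊗ₘ κ) ((fun ω : 𝒳 × 𝒴 => w ω.1) ⁻¹' D) = 1 := by
        rw [← ENNReal.toReal_eq_one_iff]; exact hval
      have h2 : (twoPoint x x' ⊗ₘ κ) ((fun ω : 𝒳 × 𝒴 => w ω.1) ⁻¹' D)ᶜ = 0 :=
        (prob_compl_eq_zero_iff (hm _ ⟨D, hD, rfl⟩)).2 h1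
      rw [h1, mul_one, measure_inter_conull h2]
    · rw [Set.indicator_of_notMem h] at hval
      have h1 : (twoPoint x x' ⊗ₘ κ) ((fun ω : 𝒳 × 𝒴 => w ω.1) ⁻¹' D) = 0 := by
        rwa [measureReal_eq_zero_iff] at hval
      rw [h1, mul_zero]
      exact measure_mono_null Set.inter_subset_right h1
  have h := condExp_indep_eq (f := s.indicator fun _ => (1 : ℝ)) le_rfl hm
    (stronglyMeasurable_const.indicator hs) hind
  filter_upwards [h] with ω hω
  rw [hω, integral_indicator hs]
  simp

/-- The conditional mutual information between an input attribute that separates two points and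
the output controls the difference of the output laws. -/
theorem ofReal_sq_le_condMutualInfo {α : Type*} [MeasurableSpace α] {x x' : 𝒳}
    {w : 𝒳 → γ} (hw : Measurable w) (hxx : w x = w x') {r : 𝒳 → α} (hr : Measurable r)
    {S : Set α} (hS : MeasurableSet S) (hxS : r x ∈ S) (hxS' : r x' ∉ S)
    {A : Set 𝒴} (hA : MeasurableSet A) :
    ENNReal.ofReal (((κ x).real A - (κ x').real A) ^ 2 / 64) ≤
      condMutualInfo (twoPoint x x' ⊗ₘ κ) (fun ω => r ω.1) (fun ω => ω.2) (fun ω => w ω.1) := by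
  classical
  set μ := twoPoint x x' ⊗ₘ κ with hμ
  let f : α → Fin 2 := fun z => if z ∈ S then 0 else 1
  let g : 𝒴 → Fin 2 := fun y => if y ∈ A then 0 else 1
  have hf : Measurable f := Measurable.ite hS measurable_const measurable_const
  have hg : Measurable g := Measurable.ite hA measurable_const measurable_const
  let q : Fin 2 → Fin 2 → ℝ := fun a b =>
    μ.real {ω' : 𝒳 × 𝒴 | f (r ω'.1) = a ∧ g ω'.2 = b}
  have hset : ∀ a b, {ω' : 𝒳 × 𝒴 | f (r ω'.1) = a ∧ g ω'.2 = b} =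
      (r ⁻¹' (f ⁻¹' {a})) ×ˢ (g ⁻¹' {b}) := fun a b => by ext; simp
  have hf0 : f ⁻¹' {0} = S := by ext z; by_cases hz : z ∈ S <;> simp [f, hz]
  have hf1 : f ⁻¹' {1} = Sᶜ := by ext z; by_cases hz : z ∈ S <;> simp [f, hz]
  have hg0 : g ⁻¹' {0} = A := by ext z; by_cases hz : z ∈ A <;> simp [g, hz]
  have hg1 : g ⁻¹' {1} = Aᶜ := by ext z; by_cases hz : z ∈ A <;> simp [g, hz]
  have hqval : ∀ a b, q a b =
      ((r ⁻¹' (f ⁻¹' {a})).indicator (fun z => (κ z).real (g ⁻¹' {b})) x +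
        (r ⁻¹' (f ⁻¹' {a})).indicator (fun z => (κ z).real (g ⁻¹' {b})) x') / 2 := fun a b => by
    simp only [q]
    rw [hset, hμ, twoPoint_compProd_real_prod x x' (hr (hf (measurableSet_singleton a)))
      (hg (measurableSet_singleton b))]
  have q00 : q 0 0 = (κ x).real A / 2 := by
    rw [hqval, hf0, hg0]; simp [Set.indicator, hxS, hxS']
  have q01 : q 0 1 = (1 - (κ x).real A) / 2 := by
    rw [hqval, hf0, hg1]; simp [Set.indicator, hxS, hxS', probReal_compl_eq_one_sub hA]
  have q10 : q 1 0 = (κ x').real A / 2 := by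
    rw [hqval, hf1, hg0]; simp [Set.indicator, hxS, hxS']
  have q11 : q 1 1 = (1 - (κ x').real A) / 2 := by
    rw [hqval, hf1, hg1]; simp [Set.indicator, hxS, hxS', probReal_compl_eq_one_sub hA]
  have hlow := sq_div_four_le_finMutualInfo (q := q) (fun a b => measureReal_nonneg)
    (by simp only [Fin.sum_univ_two, q00, q01, q10, q11]; ring) 0 0
  -- The row marginal is `1 / 2`, so the excess is a quarter of the difference of the output
  -- probabilities; squaring and dividing by `4` gives the `64`.
  have hval : (q 0 0 - (∑ b', q 0 b') * ∑ a', q a' 0) ^ 2 / 4 =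
      ((κ x).real A - (κ x').real A) ^ 2 / 64 := by
    simp only [Fin.sum_univ_two, q00, q01, q10]; ring
  rw [hval] at hlow
  refine le_trans ?_ (le_iSup_of_le 2 <| le_iSup_of_le 2 <| le_iSup_of_le f <|
    le_iSup_of_le hf <| le_iSup_of_le g <| le_iSup_of_le hg le_rfl)
  have hae : ∀ᵐ ω ∂μ, ∀ a b, (μ⟦{ω' : 𝒳 × 𝒴 | f (r ω'.1) = a ∧ g ω'.2 = b} |
      MeasurableSpace.comap (fun ω => w ω.1) inferInstance⟧) ω = q a b := by
    simp only [ae_all_iff]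
    intro a b
    refine condProb_twoPoint hw hxx ?_
    rw [hset]
    exact (hr (hf (measurableSet_singleton a))).prod (hg (measurableSet_singleton b))
  calc ENNReal.ofReal (((κ x).real A - (κ x').real A) ^ 2 / 64)
      = ∫⁻ _, ENNReal.ofReal (((κ x).real A - (κ x').real A) ^ 2 / 64) ∂μ := by simp
    _ ≤ _ := lintegral_mono_ae <| by
      filter_upwards [hae] with ω hω
      simp only [hω]
      exact ENNReal.ofReal_le_ofReal hlow

end TwoPoint

/-! ### Bounded leakage forces neighboring output laws to be close. -/

namespace Mechanism

theorem IsMIDP.abs_sub_le {M : Mechanism.{u, v}} {δ : ℝ} (hδ : 0 ≤ δ)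
    (hM : M.IsMIDP (δ ^ 2 / 64)) {x x' : ∀ i, M.X i} (hx : Neighbor x x') {A : Set M.Y}
    (hA : MeasurableSet A) : |(M.kernel x).real A - (M.kernel x').real A| ≤ δ := by
  classical
  obtain ⟨i, hi⟩ : ∃ i, ∀ j, j ≠ i → x j = x' j := by
    unfold Neighbor hammingDist at hx
    obtain ⟨i, hi⟩ := Finset.card_eq_one.1 hx
    refine ⟨i, fun j hj => ?_⟩
    by_contra hne
    have : j ∈ ({i} : Finset (Fin M.n)) := by rw [← hi]; simpa using hne
    exact hj (Finset.mem_singleton.1 this)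
  by_cases hsep : ∃ S : Set (M.X i), MeasurableSet S ∧ x i ∈ S ∧ x' i ∉ S
  · obtain ⟨S, hS, hxS, hxS'⟩ := hsep
    have hw : Measurable fun (x : ∀ i, M.X i) (j : {j : Fin M.n // j ≠ i}) => x j :=
      measurable_pi_iff.2 fun j => measurable_pi_apply _
    have hxx : (fun j : {j : Fin M.n // j ≠ i} => x j) =
        fun j : {j : Fin M.n // j ≠ i} => x' j := funext fun j => hi j j.2
    have h1 := ofReal_sq_le_condMutualInfo (κ := M.kernel) hw
      hxx
      (measurable_pi_apply i) hS hxS hxS' hA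
    have h2 : M.leakage i (twoPoint x x') ≤ ENNReal.ofReal (δ ^ 2 / 64) :=
      iSup_le_iff.1 (iSup_le_iff.1 (iSup_le_iff.1 hM i) (twoPoint x x')) inferInstance
    have h3 := (ENNReal.ofReal_le_ofReal_iff (by positivity)).1 (h1.trans h2)
    exact abs_le_of_sq_le_sq (by linarith) hδ
  -- The σ-algebra on `X i` need not separate points. If no measurable set separates the two
  -- entries, they lie in the same level set of the measurable map `y ↦ M.kernel (Function.update x
  -- i y) A`, so the output probabilities agree.
  · push Not at hsep
    have hmeas : MeasurableSet
        ((fun y => M.kernel (Function.update x i y) A) ⁻¹' {M.kernel x A}) :=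
      ((M.kernel.measurable_coe hA).comp (measurable_update x)) (measurableSet_singleton _)
    have hmem := hsep _ hmeas (by simp)
    have hupd : Function.update x i (x' i) = x' := by
      ext j
      by_cases hj : j = i
      · subst hj; simp
      · simp [hj, hi j hj]
    rw [Set.mem_preimage, hupd, Set.mem_singleton_iff] at hmem
    simpa [Measure.real, hmem] using hδ

/-- The additive bound already yields closeness with `ε = 0`; a factor `exp ε ≥ 1` only relaxes it.
-/
theorem IsMIDP.isEDDP {M : Mechanism.{u, v}} {ε δ : ℝ} (hε : 0 ≤ ε) (hδ : 0 ≤ δ)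
    (hM : M.IsMIDP (δ ^ 2 / 64)) : M.IsEDDP ε δ := by
  intro x x' hx
  have hexp := Real.one_le_exp hε
  constructor <;> intro A hA
  · have h := abs_le.1 (hM.abs_sub_le hδ hx hA)
    have h0 : 0 ≤ (M.kernel x').real A := measureReal_nonneg
    nlinarith
  · have h := abs_le.1 (hM.abs_sub_le hδ hx hA)
    have h0 : 0 ≤ (M.kernel x).real A := measureReal_nonneg
    nlinarith

end Mechanism

/-! ### Comparison of the privacy guarantees. -/

theorem stronger_miDP_epsDeltaDP (C : Set Mechanism.{u, v}) : Stronger C miDP epsDeltaDP := by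
  intro b hb
  refine ⟨fun _ => b 1 ^ 2 / 64, fun _ => by have := hb 1; positivity, fun M _ hM => ?_⟩
  exact Mechanism.IsMIDP.isEDDP (hb 0).le (hb 1).le hM

theorem stronger_epsDP_miDP (C : Set Mechanism.{u, v}) : Stronger C epsDP miDP := by
  intro b hb
  refine ⟨fun _ => b 0 / 2, fun _ => by have := hb 0; positivity, fun M _ hM => ?_⟩
  have h := Mechanism.IsEDP.isMIDP (by have := hb 0; positivity) hM
  rwa [mul_div_cancel₀ _ (two_ne_zero' ℝ)] at h

theorem stronger_epsDeltaDP_miDP (K : ℕ) :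
    Stronger {M : Mechanism.{u, v} | M.cardBound ≤ K} epsDeltaDP miDP := by
  intro b hb
  have hb0 := hb 0
  -- With `ε = log (1 + c)` and `δ = c` the leakage bound is `4 * c * K ≤ b 0`; `K + 1` in place of
  -- `K` keeps the denominator positive when `K = 0`.
  set c : ℝ := b 0 / (4 * (K + 1)) with hc
  have hc0 : 0 < c := by positivity
  have hlog : 0 < Real.log (1 + c) := Real.log_pos (by linarith)
  refine ⟨![Real.log (1 + c), c], fun j => ?_, fun M hMK hM => ?_⟩
  · fin_cases j
    · exact hlog
    · exact hc0
  · have h := Mechanism.IsEDDP.isMIDP hlog.le hc0.le hMK hM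
    refine le_trans h (ENNReal.ofReal_le_ofReal ?_)
    rw [Real.exp_log (by linarith)]
    have : c * (4 * (K + 1)) = b 0 := by rw [hc]; field_simp
    nlinarith

theorem theorem1 :
    Stronger (Set.univ : Set Mechanism.{u, v}) epsDP miDP ∧
      Stronger (Set.univ : Set Mechanism.{u, v}) miDP epsDeltaDP ∧
      ∀ K : ℕ, EquivalentDP {M : Mechanism.{u, v} | M.cardBound ≤ K} miDP epsDeltaDP :=
  ⟨stronger_epsDP_miDP _, stronger_miDP_epsDeltaDP _,
    fun K => ⟨stronger_miDP_epsDeltaDP _, stronger_epsDeltaDP_miDP K⟩⟩
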